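/- Let $q$ be a prime power, $K=\mathbb{F}_q$, $n\ge 0$ and $d\ge 1$. Represent each point of $\mathbb{P}^n=\mathbb{P}^n(\mathbb{F}_q)$ by its unique representative in $K^{n+1}$ whose first nonzero entry equals $1$, and let $P_1,\dots,P_m$ be these representatives. Let $S_d$ be the $K$-vector space of homogeneous polynomials of degree $d$ in $K[X_0,\dots,X_n]$, together with $0$. The projective Reed–Muller code of order $d$ is the linear code $$C_{\mathbb{P}^n}(d)=\{(f(P_1),\dots,f(P_m)) : f\in S_d\}\subseteq K^{m}.$$ Its length is $m=|\mathbb{P}^n|$, its dimension is its dimension as a $K$-vector space, and its minimum distance $\delta_{\mathbb{P}^n}(d)$ is the minimum number of nonzero entries of a nonzero codeword. Then: (a) $|\mathbb{P}^n| = \dfrac{q^{n+1}-1}{q-1}$. (b) $\displaystyle \dim_K C_{\mathbb{P}^n}(d)=\sum_{j=0}^{n}\sum_{k=0}^{j}(-1)^k\binom{j}{k}\binom{j+d-1-kq}{d-1-kq}$, where $\binom{a}{b}=0$ if $b<0$. (c) $$\delta_{\mathbb{P}^n}(d)=\begin{cases} q^n & \text{if } d=1,\\ (q-\ell)\,q^{\,n-k-1}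 & \text{if } 1<d\le n(q-1),\\ 1 & \text{if } n(q-1)<d,\end{cases}$$ where, for $1<d\le n(q-1)$, $k$ and $\ell$ are the unique integers with $0\le k\le n-1$, $1\le \ell\le q-1$ and $d=1+k(q-1)+\ell$. (The first and third cases overlap only for $n=0$, $d=1$, where both values are $1$.) -/

import Mathlib

open scoped LinearAlgebra.Projectivization

/-- The first (leftmost) nonzero entry of a vector, with value `0` at the zero vector. -/
noncomputable def leadingEntry {K : Type*} [Field K] {n : ℕ} (v : Fin (n + 1) → K) : K :=
  open Classical in
  if h : ∃ i, v i ≠ 0 ∧ ∀ j < i, v j = 0 then v h.choose else 0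

theorem exists_leading {K : Type*} [Field K] {n : ℕ} {v : Fin (n + 1) → K} (hv : v ≠ 0) :
    ∃ i, v i ≠ 0 ∧ ∀ j < i, v j = 0 := by
  classical
  have hne : (Finset.univ.filter fun i => v i ≠ 0).Nonempty := by
    obtain ⟨i, hi⟩ := Function.ne_iff.mp hv
    exact ⟨i, by simpa using hi⟩
  refine ⟨Finset.min' _ hne, ?_, ?_⟩
  · simpa using Finset.min'_mem _ hne
  · intro j hj
    by_contra h
    exact absurd (Finset.min'_le (Finset.univ.filter fun i => v i ≠ 0) j (by simpa using h))
      (not_le.mpr hj)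

/-- The usual representative of a projective point: zeros to the left, and the first nonzero
entry equal to `1`. -/
noncomputable def stdRep {K : Type*} [Field K] {n : ℕ} (P : ℙ K (Fin (n + 1) → K)) :
    Fin (n + 1) → K :=
  (leadingEntry P.rep)⁻¹ • P.rep

theorem stdRep_normalized {K : Type*} [Field K] {n : ℕ} (P : ℙ K (Fin (n + 1) → K)) :
    ∃ i, stdRep P i = 1 ∧ ∀ j < i, stdRep P j = 0 := by
  have h := exists_leading P.rep_nonzero
  refine ⟨h.choose, ?_, fun j hj => ?_⟩
  · simp only [stdRep, leadingEntry, dif_pos h, Pi.smul_apply, smul_eq_mul]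
    exact inv_mul_cancel₀ h.choose_spec.1
  · simp [stdRep, h.choose_spec.2 j hj]

theorem stdRep_ne_zero {K : Type*} [Field K] {n : ℕ} (P : ℙ K (Fin (n + 1) → K)) :
    stdRep P ≠ 0 := by
  obtain ⟨i, hi, -⟩ := stdRep_normalized P
  intro h
  simp [h] at hi

theorem mk_stdRep {K : Type*} [Field K] {n : ℕ} (P : ℙ K (Fin (n + 1) → K)) :
    Projectivization.mk K (stdRep P) (stdRep_ne_zero P) = P := by
  conv_rhs => rw [← P.mk_rep]
  rw [Projectivization.mk_eq_mk_iff']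
  exact ⟨_, rfl⟩

/-- The evaluation map from the homogeneous polynomials of degree `d` in `X₀, …, Xₙ` (together
with `0`) to the `K`-valued words indexed by the points of `ℙⁿ(K)`. -/
noncomputable def projEval (K : Type*) [Field K] (n d : ℕ) :
    MvPolynomial.homogeneousSubmodule (Fin (n + 1)) K d →ₗ[K] (ℙ K (Fin (n + 1) → K) → K) where
  toFun f := fun P => MvPolynomial.eval (stdRep P) (f : MvPolynomial (Fin (n + 1)) K)
  map_add' f g := by ext P; simp
  map_smul' a f := by ext P; simp [MvPolynomial.smul_eval]

/-- The projective Reed–Muller code of order `d` over `ℙⁿ(K)`. -/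
noncomputable def projReedMuller (K : Type*) [Field K] (n d : ℕ) :
    Submodule K (ℙ K (Fin (n + 1) → K) → K) :=
  LinearMap.range (projEval K n d)

/-- The Hamming weight (number of nonzero entries) of a word. -/
noncomputable def wordWeight {ι K : Type*} [Finite ι] [Field K] (c : ι → K) : ℕ :=
  open Classical in
  letI := Fintype.ofFinite ι
  hammingNorm c

/-- `δ` is the minimum distance of the linear code `C`: the minimum (attained) of the weights of
the nonzero words of `C`. -/
def IsMinDist {ι K : Type*} [Finite ι] [Field K] (C : Submodule K (ι → K)) (δ : ℕ) : Prop :=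
  IsLeast {w : ℕ | ∃ c ∈ C, c ≠ 0 ∧ w = wordWeight c} δ

/-- The binomial coefficient `a` over `b` for integers, equal to `0` if `b < 0`. -/
noncomputable def intBinom (a b : ℤ) : ℤ :=
  if b < 0 then 0 else Ring.choose a b.toNat

/-! Polynomials are replaced by the functions they define. With `L = linFun K V`, the power `L ^ d`
is the space of homogeneous functions of degree `d` and `(1 ⊔ L) ^ d` that of polynomial functions
of degree at most `d`. This is coordinate free, so hyperplanes can be treated as spaces in their own
right. For `d ≥ 1` a homogeneous function is determined by its values on the representatives, so the
code is a copy of `L ^ d`.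

Dimension: restrict from `K × W` to `c = 0`. The image is everything of degree `d` on `W`; the
kernel is `c` times degree `d - 1`, and on the chart `c = 1` it becomes the functions of degree at
most `d - 1` on `W` (`finrank_linFun_prod_pow`). Iterating gives a sum over `j` of numbers of
monomials with all exponents at most `q - 1`, which have generating function `(1 - T ^ q) ^ j / (1 -
T) ^ (j + 1)`; expanding gives (b).

Lower bound: count nonzero values on all of `V`, which is `q - 1` times the weight
(`cone_weight_bound`). If `f` vanishes on a hyperplane, dehomogenizing lowers the degree by one and
the affine footprint bound applies. Otherwise `f` is nonzero on every hyperplane; induction bounds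
each restriction, and double counting incident pairs (hyperplane, vector) gains a factor `q`.
Products of linear forms attain the bound. -/

/-! ### Polynomial functions on a vector space -/

/-- The linear functionals on `V`, as a subspace of the algebra of functions `V → K`. -/
def linFun (K V : Type*) [Field K] [AddCommGroup V] [Module K V] : Submodule K (V → K) :=
  LinearMap.range (LinearMap.ltoFun K V K K)

/-- Precomposition with a map, as a homomorphism of algebras of functions. -/
def pullback (K : Type*) [Field K] {W V : Type*} (φ : W → V) : (V → K) →ₐ[K] (W → K) where
  toFun f := f ∘ φ
  map_one' := rfl
  map_mul' _ _ := rfl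
  map_zero' := rfl
  map_add' _ _ := rfl
  commutes' _ := rfl

section FunctionAlgebra

variable {K V W : Type*} [Field K] [AddCommGroup V] [Module K V] [AddCommGroup W] [Module K W]

@[simp]
theorem pullback_apply {X Y : Type*} (φ : X → Y) (f : Y → K) (x : X) :
    pullback K φ f x = f (φ x) := rfl

theorem map_pullback_linFun_le (φ : W →ₗ[K] V) :
    (linFun K V).map (pullback K φ).toLinearMap ≤ linFun K W := by
  rintro _ ⟨_, ⟨l, rfl⟩, rfl⟩
  exact ⟨l ∘ₗ φ, rfl⟩

/-- Equality holds because functionals on a subspace extend to the whole space. -/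
theorem map_pullback_linFun {φ : W →ₗ[K] V} (hφ : Function.Injective φ) :
    (linFun K V).map (pullback K φ).toLinearMap = linFun K W := by
  refine le_antisymm (map_pullback_linFun_le φ) ?_
  rintro _ ⟨l, rfl⟩
  obtain ⟨m, rfl⟩ := LinearMap.dualMap_surjective_of_injective hφ l
  exact ⟨m, ⟨m, rfl⟩, rfl⟩

theorem map_pullback_linFun_pow {φ : W →ₗ[K] V} (hφ : Function.Injective φ) (d : ℕ) :
    (linFun K V ^ d).map (pullback K φ).toLinearMap = linFun K W ^ d := by
  rw [Submodule.map_pow, map_pullback_linFun hφ]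

theorem pullback_mem_linFun_pow (φ : W →ₗ[K] V) {d : ℕ} {f : V → K} (hf : f ∈ linFun K V ^ d) :
    pullback K φ f ∈ linFun K W ^ d := by
  have h : pullback K φ f ∈ (linFun K V ^ d).map (pullback K φ).toLinearMap := ⟨f, hf, rfl⟩
  rw [Submodule.map_pow] at h
  exact pow_le_pow_left' (map_pullback_linFun_le φ) d h

/-- Dehomogenization: on the chart `c = 1` a linear form becomes a constant plus a linear form.
Since `pullback` is multiplicative, powers follow. -/
theorem map_pullback_one_prod :
    (linFun K (K × W)).map (pullback K (fun w : W => ((1 : K), w))).toLinearMap =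
      1 ⊔ linFun K W := by
  apply le_antisymm
  · rintro _ ⟨_, ⟨l, rfl⟩, rfl⟩
    refine Submodule.mem_sup.2 ⟨algebraMap K (W → K) (l (1, 0)), Submodule.algebraMap_mem _,
      _, ⟨l ∘ₗ LinearMap.inr K K W, rfl⟩, ?_⟩
    ext w
    simp [← map_add]
  · refine sup_le ?_ ?_
    · rw [Submodule.one_le]
      exact ⟨_, ⟨LinearMap.fst K K W, rfl⟩, rfl⟩
    · rintro _ ⟨l, rfl⟩
      exact ⟨_, ⟨l ∘ₗ LinearMap.snd K K W, rfl⟩, rfl⟩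

theorem map_pullback_one_prod_pow (d : ℕ) :
    (linFun K (K × W) ^ d).map (pullback K (fun w : W => ((1 : K), w))).toLinearMap =
      (1 ⊔ linFun K W) ^ d := by
  rw [Submodule.map_pow, map_pullback_one_prod]

/-- A homogeneous function is homogeneous under scaling. -/
theorem smul_apply_of_mem_linFun_pow {d : ℕ} {f : V → K} (hf : f ∈ linFun K V ^ d) (c : K)
    (v : V) : f (c • v) = c ^ d * f v := by
  induction d generalizing f with
  | zero =>
    obtain ⟨a, rfl⟩ := Submodule.mem_one.1 (by simpa using hf)
    simp
  | succ d ih =>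
    rw [pow_succ] at hf
    induction hf using Submodule.mul_induction_on' with
    | mem_mul_mem g hg l hl =>
      obtain ⟨l, rfl⟩ := hl
      simp only [Pi.mul_apply, ih hg, LinearMap.ltoFun_apply, map_smul, smul_eq_mul]
      ring
    | add g _ h _ hg hh => simp only [Pi.add_apply, hg, hh, mul_add]

/-- Every homogeneous function of degree `e + 1` on `K × W` splits off the first coordinate. -/
theorem exists_eq_fst_mul_add {e : ℕ} {f : K × W → K} (hf : f ∈ linFun K (K × W) ^ (e + 1)) :
    ∃ h ∈ linFun K (K × W) ^ e, ∃ r ∈ linFun K W ^ (e + 1),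
      f = Prod.fst * h + pullback K Prod.snd r := by
  have key : ∀ f ∈ linFun K (K × W), ∃ a : K, ∃ r ∈ linFun K W,
      f = a • Prod.fst + pullback K Prod.snd r := by
    rintro _ ⟨l, rfl⟩
    refine ⟨l (1, 0), _, ⟨l ∘ₗ LinearMap.inr K K W, rfl⟩, ?_⟩
    ext ⟨c, w⟩
    have : ((c, w) : K × W) = c • (1, 0) + (0, w) := by simp
    simp only [LinearMap.ltoFun_apply]
    rw [this, map_add, map_smul]
    simp [mul_comm]
  induction e generalizing f with
  | zero =>
    obtain ⟨a, r, hr, rfl⟩ := key f (by simpa using hf)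
    refine ⟨algebraMap K _ a, ?_, r, by simpa using hr, ?_⟩
    · simp
    · ext x
      simp [mul_comm]
  | succ e ih =>
    rw [pow_succ] at hf
    induction hf using Submodule.mul_induction_on' with
    | mem_mul_mem g hg l hl =>
      obtain ⟨h, hh, r, hr, rfl⟩ := ih hg
      obtain ⟨a, s, hs, rfl⟩ := key l hl
      -- Expand `(c h + r)(a c + s) = c (h (a c + s) + a r) + r s`.
      refine ⟨h * (a • Prod.fst + pullback K Prod.snd s) + a • pullback K Prod.snd r,
        add_mem ?_ (Submodule.smul_mem _ _ ?_), r * s, ?_, ?_⟩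
      · rw [pow_succ]
        exact Submodule.mul_mem_mul hh hl
      · exact pullback_mem_linFun_pow (LinearMap.snd K K W) hr
      · rw [pow_succ]
        exact Submodule.mul_mem_mul hr hs
      · ext x
        simp
        ring
    | add g _ g' _ hg hg' =>
      obtain ⟨h, hh, r, hr, rfl⟩ := hg
      obtain ⟨h', hh', r', hr', rfl⟩ := hg'
      exact ⟨h + h', add_mem hh hh', r + r', add_mem hr hr', by rw [map_add]; ring⟩

/-- A homogeneous function vanishing on the hyperplane at infinity has lower degree on the affine
part. -/
theorem exists_eq_fst_mul {e : ℕ} {f : K × W → K} (hf : f ∈ linFun K (K × W) ^ (e + 1))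
    (h0 : ∀ w, f (0, w) = 0) : ∃ h ∈ linFun K (K × W) ^ e, f = Prod.fst * h := by
  obtain ⟨h, hh, r, -, rfl⟩ := exists_eq_fst_mul_add hf
  refine ⟨h, hh, ?_⟩
  ext ⟨c, w⟩
  simpa using h0 w

theorem pullback_one_mem {e : ℕ} {f : K × W → K} (hf : f ∈ linFun K (K × W) ^ (e + 1))
    (h0 : ∀ w, f (0, w) = 0) :
    pullback K (fun w : W => ((1 : K), w)) f ∈ (1 ⊔ linFun K W) ^ e := by
  obtain ⟨h, hh, rfl⟩ := exists_eq_fst_mul hf h0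
  rw [← map_pullback_one_prod_pow]
  refine ⟨h, hh, ?_⟩
  ext w
  simp

theorem finrank_linFun_pow_eq_of_equiv (φ : W ≃ₗ[K] V) (d : ℕ) :
    Module.finrank K ↥(linFun K W ^ d) = Module.finrank K ↥(linFun K V ^ d) := by
  rw [← map_pullback_linFun_pow φ.injective (φ := φ.toLinearMap)]
  have hinj : Function.Injective (pullback K φ).toLinearMap := by
    intro f g h
    ext v
    simpa using congrFun h (φ.symm v)
  exact (Submodule.equivMapOfInjective _ hinj (linFun K V ^ d)).finrank_eq.symm

/-- Rank–nullity for `ρ`, restriction to `c = 0`; its kernel is identified by `τ`, restriction to `c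
= 1`. -/
theorem finrank_linFun_prod_pow [Finite K] [Finite W] (e : ℕ) :
    Module.finrank K ↥(linFun K (K × W) ^ (e + 1)) =
      Module.finrank K ↥(linFun K W ^ (e + 1)) + Module.finrank K ↥((1 ⊔ linFun K W) ^ e) := by
  set H := linFun K (K × W) ^ (e + 1)
  let ρ : H →ₗ[K] (W → K) := (pullback K (LinearMap.inr K K W)).toLinearMap.domRestrict H
  let τ : LinearMap.ker ρ →ₗ[K] (W → K) :=
    (pullback K (fun w : W => ((1 : K), w))).toLinearMap ∘ₗ H.subtype ∘ₗ (LinearMap.ker ρ).subtype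
  have hρ : LinearMap.range ρ = linFun K W ^ (e + 1) := by
    rw [← map_pullback_linFun_pow (LinearMap.inr_injective (R := K) (M := K) (M₂ := W))]
    exact LinearMap.range_domRestrict _ _
  have hker : ∀ f : LinearMap.ker ρ, ∀ w, f.1.1 (0, w) = 0 := fun f w => congrFun f.2 w
  have hτ : LinearMap.range τ = (1 ⊔ linFun K W) ^ e := by
    apply le_antisymm
    · rintro _ ⟨f, rfl⟩
      exact pullback_one_mem f.1.2 (hker f)
    · rw [← map_pullback_one_prod_pow]
      rintro _ ⟨h, hh, rfl⟩
      refine ⟨⟨⟨Prod.fst * h, ?_⟩, ?_⟩, ?_⟩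
      · change _ ∈ linFun K (K × W) ^ (e + 1)
        rw [pow_succ']
        exact Submodule.mul_mem_mul ⟨LinearMap.fst K K W, rfl⟩ hh
      · ext w
        simp [ρ]
      · ext w
        simp [τ]
  -- Points with `c ≠ 0` are multiples of points with `c = 1`, so homogeneity determines the
  -- function from the two slices.
  have hinj : Function.Injective τ := by
    rw [injective_iff_map_eq_zero]
    intro f hf
    ext ⟨c, w⟩
    by_cases hc : c = 0
    · subst hc
      exact hker f w
    · have h1 : f.1.1 (1, c⁻¹ • w) = 0 := congrFun hf _
      have := smul_apply_of_mem_linFun_pow f.1.2 c (1, c⁻¹ • w)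
      simpa [h1, smul_smul, hc] using this
  rw [← hρ, ← hτ, LinearMap.finrank_range_of_inj hinj, LinearMap.finrank_range_add_finrank_ker]

end FunctionAlgebra

/-! ### Polynomials and the functions they define -/

section PolynomialFunctions

open MvPolynomial

variable (K : Type*) [Field K] (m : ℕ)

/-- Evaluation of polynomials as a homomorphism to the algebra of functions. -/
noncomputable def evalAlg : MvPolynomial (Fin m) K →ₐ[K] ((Fin m → K) → K) :=
  aeval fun i x => x i

variable {K m}

@[simp]
theorem evalAlg_apply (p : MvPolynomial (Fin m) K) (x : Fin m → K) :
    evalAlg K m p x = eval x p := by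
  induction p using MvPolynomial.induction_on with
  | C a => simp [evalAlg]
  | add p r hp hr => simp [hp, hr]
  | mul_X p i hp => simp only [map_mul, Pi.mul_apply, hp, eval_X]; simp [evalAlg]

theorem map_evalAlg_homogeneousSubmodule_one :
    (homogeneousSubmodule (Fin m) K 1).map (evalAlg K m).toLinearMap = linFun K (Fin m → K) := by
  rw [homogeneousSubmodule_one_eq_span_X, Submodule.map_span]
  apply le_antisymm
  · rw [Submodule.span_le]
    rintro _ ⟨_, ⟨i, rfl⟩, rfl⟩
    exact ⟨LinearMap.proj i, by ext x; simp⟩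
  · rintro _ ⟨l, rfl⟩
    have : LinearMap.ltoFun K (Fin m → K) K K l =
        ∑ i, l (Pi.single i 1) • evalAlg K m (X i) := by
      ext x
      have hx : x = ∑ i, x i • Pi.single i (1 : K) := by
        ext j
        simp [Pi.single_apply]
      rw [LinearMap.ltoFun_apply]
      conv_lhs => rw [hx, map_sum]
      simp [mul_comm]
    rw [this]
    exact sum_mem fun i _ => Submodule.smul_mem _ _ (Submodule.subset_span ⟨_, ⟨i, rfl⟩, rfl⟩)

theorem map_evalAlg_homogeneousSubmodule (d : ℕ) :
    (homogeneousSubmodule (Fin m) K d).map (evalAlg K m).toLinearMap =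
      linFun K (Fin m → K) ^ d := by
  rw [← homogeneousSubmodule_one_pow, Submodule.map_pow, map_evalAlg_homogeneousSubmodule_one]

theorem map_evalAlg_restrictTotalDegree (d : ℕ) :
    (restrictTotalDegree (Fin m) K d).map (evalAlg K m).toLinearMap =
      (1 ⊔ linFun K (Fin m → K)) ^ d := by
  rw [← map_evalAlg_homogeneousSubmodule_one, ← Submodule.map_one (evalAlg K m),
    ← Submodule.map_sup, ← Submodule.map_pow]
  congr 1
  apply le_antisymm
  · intro p hp
    rw [mem_restrictTotalDegree] at hp
    rw [← sum_homogeneousComponent p]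
    refine sum_mem fun i hi => ?_
    have hi' : i ≤ d := by
      rw [Finset.mem_range] at hi
      omega
    refine pow_le_pow_right' (le_sup_left : (1 : Submodule K (MvPolynomial (Fin m) K)) ≤ _) hi' ?_
    have h := pow_le_pow_left' (le_sup_right : homogeneousSubmodule (Fin m) K 1 ≤ 1 ⊔ _) i
    rw [homogeneousSubmodule_one_pow] at h
    apply h
    exact homogeneousComponent_mem i p
  · induction d with
    | zero =>
      rw [pow_zero]
      intro p hp
      obtain ⟨a, rfl⟩ := Submodule.mem_one.1 hp
      simp [mem_restrictTotalDegree, algebraMap_eq]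
    | succ d ih =>
      rw [pow_succ, Submodule.mul_le]
      intro p hp r hr
      rw [mem_restrictTotalDegree]
      refine (totalDegree_mul _ _).trans
        (add_le_add ((mem_restrictTotalDegree _ _ _).1 (ih hp)) ?_)
      obtain ⟨s, hs, t, ht, rfl⟩ := Submodule.mem_sup.1 hr
      obtain ⟨a, rfl⟩ := Submodule.mem_one.1 hs
      refine (totalDegree_add _ _).trans (max_le (by simp [algebraMap_eq]) ?_)
      exact IsHomogeneous.totalDegree_le ht

/-- The exponents of monomials of degree at most `d` that are reduced modulo `xᵢ ^ q = xᵢ`. -/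
def reducedExponents (q m d : ℕ) : Set (Fin m →₀ ℕ) :=
  {a | (∀ i, a i ≤ q - 1) ∧ ∑ i, a i ≤ d}

theorem reducedExponents_finite (q m d : ℕ) : (reducedExponents q m d).Finite := by
  refine Set.Finite.of_injOn (f := fun a : Fin m →₀ ℕ => (a : Fin m → ℕ))
    (t := Set.Iic fun _ => q - 1) (fun a ha i => ha.1 i) (DFunLike.coe_injective.injOn)
    (Set.finite_Iic _)

theorem exists_reduced_pow [Finite K] (a : ℕ) :
    ∃ b ≤ a, b ≤ Nat.card K - 1 ∧ ∀ x : K, x ^ a = x ^ b := by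
  have := Fintype.ofFinite K
  have hq : 1 < Nat.card K := Finite.one_lt_card
  induction a using Nat.strong_induction_on with
  | _ a ih =>
    by_cases ha : a ≤ Nat.card K - 1
    · exact ⟨a, le_rfl, ha, fun _ => rfl⟩
    · obtain ⟨b, hb, hb', h⟩ := ih (a - (Nat.card K - 1)) (by omega)
      refine ⟨b, by omega, hb', fun x => ?_⟩
      rw [← h]
      -- `x ^ q = x` lowers the exponent by `q - 1`. It stays at least `1`, so the identity also
      -- holds at `x = 0`.
      have h1 : a = Nat.card K + (a - Nat.card K) := by omega
      have h2 : a - (Nat.card K - 1) = 1 + (a - Nat.card K) := by omega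
      rw [h2]
      conv_lhs => rw [h1]
      rw [pow_add, pow_add, Nat.card_eq_fintype_card, FiniteField.pow_card, pow_one]

theorem map_evalAlg_reduced [Finite K] (d : ℕ) :
    (restrictSupport K (reducedExponents (Nat.card K) m d)).map (evalAlg K m).toLinearMap =
      (1 ⊔ linFun K (Fin m → K)) ^ d := by
  rw [← map_evalAlg_restrictTotalDegree]
  apply le_antisymm
  · apply Submodule.map_mono
    refine restrictSupport_mono K fun a ha => ?_
    rw [Set.mem_ofPred_eq, Finsupp.sum_fintype _ _ fun _ => rfl]
    exact ha.2
  · rw [restrictTotalDegree, restrictSupport_eq_span, Submodule.map_span, Submodule.span_le]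
    rintro _ ⟨_, ⟨a, ha, rfl⟩, rfl⟩
    rw [Set.mem_ofPred_eq, Finsupp.sum_fintype _ _ fun _ => rfl] at ha
    choose b hb hb' h using fun i => exists_reduced_pow (K := K) (a i)
    refine ⟨monomial (Finsupp.equivFunOnFinite.symm b) 1, ?_, ?_⟩
    · refine (monomial_mem_restrictSupport K).2 (Or.inl ⟨hb', ?_⟩)
      exact (Finset.sum_le_sum fun i _ => hb i).trans ha
    · ext x
      simp [eval_monomial, Finsupp.prod_fintype, h]

theorem degreeOf_lt_of_mem_reduced [Finite K] {d : ℕ} {p : MvPolynomial (Fin m) K}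
    (hp : p ∈ restrictSupport K (reducedExponents (Nat.card K) m d)) (i : Fin m) :
    p.degreeOf i < Nat.card K := by
  have hq : 1 < Nat.card K := Finite.one_lt_card
  have : p.degreeOf i ≤ Nat.card K - 1 := degreeOf_le_iff.2 fun a ha => (hp ha).1 i
  omega

theorem totalDegree_le_of_mem_reduced {q d : ℕ} {p : MvPolynomial (Fin m) K}
    (hp : p ∈ restrictSupport K (reducedExponents q m d)) : p.totalDegree ≤ d := by
  rw [← mem_restrictTotalDegree]
  refine restrictSupport_mono K (fun a ha => ?_) hp
  rw [Set.mem_ofPred_eq, Finsupp.sum_fintype _ _ fun _ => rfl]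
  exact ha.2

/-- A nonzero polynomial of degree below `q` in each variable cannot vanish on the whole grid `K ^
m`; hence reduced monomials are independent as functions. -/
theorem eq_zero_of_evalAlg_eq_zero [Finite K] {p : MvPolynomial (Fin m) K}
    (hp : ∀ i, p.degreeOf i < Nat.card K) (h : evalAlg K m p = 0) : p = 0 := by
  have := Fintype.ofFinite K
  refine MvPolynomial.eq_zero_of_eval_zero_at_prod_finset p (fun _ => Finset.univ) ?_ ?_
  · simpa [← Nat.card_eq_fintype_card] using hp
  · intro x _
    simpa using congrFun h x

theorem finrank_one_sup_linFun_pow [Finite K] (d : ℕ) :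
    Module.finrank K ↥((1 ⊔ linFun K (Fin m → K)) ^ d) =
      (reducedExponents (Nat.card K) m d).ncard := by
  set S := restrictSupport K (reducedExponents (Nat.card K) m d) with hS
  have := (reducedExponents_finite (Nat.card K) m d).fintype
  let φ : S →ₗ[K] ((Fin m → K) → K) := (evalAlg K m).toLinearMap.domRestrict S
  have hinj : Function.Injective φ := by
    rw [injective_iff_map_eq_zero]
    intro p hp
    exact Subtype.ext (eq_zero_of_evalAlg_eq_zero (degreeOf_lt_of_mem_reduced p.2) hp)
  rw [← map_evalAlg_reduced, ← LinearMap.range_domRestrict, LinearMap.finrank_range_of_inj hinj,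
    Module.finrank_eq_card_basis (basisRestrictSupport K (reducedExponents (Nat.card K) m d)),
    ← Nat.card_eq_fintype_card, Nat.card_coe_set_eq]

end PolynomialFunctions

/-! ### Counting reduced exponents -/

section Counting

theorem reducedExponents_zero_ncard (q d : ℕ) : (reducedExponents q 0 d).ncard = 1 := by
  have : reducedExponents q 0 d = {0} := by
    ext a
    simp [reducedExponents, Subsingleton.elim a 0]
  rw [this, Set.ncard_singleton]

/-- The number of reduced exponents of degree at most `d`, for an integer `d`. -/
noncomputable def reducedCount (q m : ℕ) (d : ℤ) : ℤ :=
  if d < 0 then 0 else (reducedExponents q m d.toNat).ncard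

theorem reducedExponents_succ_ncard (q m d : ℕ) (hq : 1 ≤ q) :
    ((reducedExponents q (m + 1) d).ncard : ℤ) =
      ∑ a ∈ Finset.range q, reducedCount q m (d - a) := by
  classical
  set T := (reducedExponents_finite q (m + 1) d).toFinset with hT
  have hcoe : ∀ a, (((T.filter fun c => c 0 = a) : Finset (Fin (m + 1) →₀ ℕ)) : Set _) =
      {c | c ∈ reducedExponents q (m + 1) d ∧ c 0 = a} := fun a => by
    ext c
    simp [hT]
  have hcard : ∀ a ∈ Finset.range q,
      ({c | c ∈ reducedExponents q (m + 1) d ∧ c 0 = a}.ncard : ℤ) =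
        reducedCount q m (d - a) := by
    intro a ha
    rw [Finset.mem_range] at ha
    unfold reducedCount
    split_ifs with h
    · have : {c | c ∈ reducedExponents q (m + 1) d ∧ c 0 = a} = ∅ := by
        ext c
        simp only [Set.mem_ofPred_eq, Set.mem_empty_iff_false, iff_false]
        rintro ⟨hc, rfl⟩
        have := hc.2
        rw [Fin.sum_univ_succ] at this
        omega
      simp [this]
    · have had : a ≤ d := by omega
      have hd : ((d : ℤ) - a).toNat = d - a := by omega
      rw [hd]
      have : {c | c ∈ reducedExponents q (m + 1) d ∧ c 0 = a} =
          (Finsupp.cons a) '' reducedExponents q m (d - a) := by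
        ext c
        constructor
        · rintro ⟨hc, rfl⟩
          refine ⟨c.tail, ⟨fun i => hc.1 i.succ, ?_⟩, Finsupp.cons_tail c⟩
          have := hc.2
          rw [Fin.sum_univ_succ] at this
          simp only [Finsupp.tail_apply]
          omega
        · rintro ⟨b, hb, rfl⟩
          refine ⟨⟨fun i => ?_, ?_⟩, Finsupp.cons_zero a b⟩
          · refine Fin.cases ?_ (fun i => ?_) i
            · simp
              omega
            · simpa using hb.1 i
          · have := hb.2
            simp only [Fin.sum_univ_succ, Finsupp.cons_zero, Finsupp.cons_succ]
            omega
      rw [this, Set.ncard_image_of_injective _ (Finsupp.cons_right_injective a)]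
  have hmaps : ∀ c ∈ T, c 0 ∈ Finset.range q := by
    intro c hc
    have := ((Set.Finite.mem_toFinset _).1 hc).1 0
    rw [Finset.mem_range]
    omega
  rw [Set.ncard_eq_toFinset_card _ (reducedExponents_finite q (m + 1) d),
    Finset.card_eq_sum_card_fiberwise hmaps, Nat.cast_sum]
  refine Finset.sum_congr rfl fun a ha => ?_
  rw [← hcard a ha, ← hcoe a, Set.ncard_coe_finset]

theorem reducedCount_of_neg {q m : ℕ} {d : ℤ} (hd : d < 0) : reducedCount q m d = 0 := if_pos hd

theorem reducedCount_natCast (q m d : ℕ) :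
    reducedCount q m d = (reducedExponents q m d).ncard := by
  simp [reducedCount]

/-- Fixing the first exponent writes the count as a sum over a window of length `q`; passing from `d
- 1` to `d` adds one end and drops the other. The value `0` at negative degrees avoids boundary
cases. -/
theorem reducedCount_succ_sub {q : ℕ} (hq : 1 ≤ q) (m : ℕ) (d : ℤ) :
    reducedCount q (m + 1) d =
      reducedCount q (m + 1) (d - 1) + reducedCount q m d - reducedCount q m (d - q) := by
  have hsum : ∀ d : ℤ, reducedCount q (m + 1) d =
      ∑ a ∈ Finset.range q, reducedCount q m (d - a) := by
    intro d
    by_cases hd : d < 0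
    · rw [reducedCount_of_neg hd, Finset.sum_eq_zero]
      intro a _
      exact reducedCount_of_neg (by omega)
    · lift d to ℕ using not_lt.1 hd
      rw [reducedCount_natCast, reducedExponents_succ_ncard q m d hq]
  rw [hsum, hsum]
  have h1 := Finset.sum_range_succ (fun a : ℕ => reducedCount q m (d - a)) q
  have h2 := Finset.sum_range_succ' (fun a : ℕ => reducedCount q m (d - a)) q
  have h3 : ∀ a : ℕ, reducedCount q m (d - 1 - a) = reducedCount q m (d - (a + 1 : ℕ)) := by
    intro a
    congr 1
    push_cast
    ring
  simp only [h3]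
  simp only [Nat.cast_zero, sub_zero] at h2
  linarith

/-- The number of monomials of degree at most `b` in `j` variables, for an integer `b`. -/
noncomputable def monomialCount (j : ℕ) (b : ℤ) : ℤ := intBinom (j + b) b

theorem monomialCount_of_neg {j : ℕ} {b : ℤ} (hb : b < 0) : monomialCount j b = 0 := if_pos hb

theorem monomialCount_natCast (j b : ℕ) : monomialCount j b = (j + b).choose b := by
  rw [monomialCount, intBinom, if_neg (by omega), ← Nat.cast_add, Ring.choose_natCast]
  simp

theorem monomialCount_succ (j : ℕ) (b : ℤ) :
    monomialCount (j + 1) b = monomialCount (j + 1) (b - 1) + monomialCount j b := by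
  rcases lt_trichotomy b 0 with hb | rfl | hb
  · rw [monomialCount_of_neg hb, monomialCount_of_neg hb, monomialCount_of_neg (by omega), add_zero]
  · have h := fun j => monomialCount_natCast j 0
    simp only [Nat.cast_zero, Nat.choose_zero_right, Nat.cast_one] at h
    rw [monomialCount_of_neg (b := 0 - 1) (by omega), h, h, zero_add]
  · obtain ⟨c, rfl⟩ : ∃ c : ℕ, b = (c + 1 : ℕ) := ⟨b.toNat - 1, by omega⟩
    have : ((c + 1 : ℕ) : ℤ) - 1 = c := by push_cast; ring
    rw [this, monomialCount_natCast, monomialCount_natCast, monomialCount_natCast]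
    have h := Nat.choose_succ_succ (j + 1 + c) c
    rw [show j + 1 + (c + 1) = (j + 1 + c) + 1 by ring, show j + (c + 1) = j + 1 + c by ring]
    exact_mod_cast h

/-- Both sides vanish for `d < 0` and satisfy the recurrence of `reducedCount_succ_sub`. -/
theorem reducedCount_eq_sum {q : ℕ} (hq : 1 ≤ q) (m : ℕ) (d : ℤ) :
    reducedCount q m d =
      ∑ k ∈ Finset.range (m + 1), (-1 : ℤ) ^ k * (m.choose k : ℤ) * monomialCount m (d - k * q) := by
  induction m generalizing d with
  | zero =>
    by_cases hd : d < 0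
    · simp [reducedCount_of_neg hd, monomialCount_of_neg hd]
    · lift d to ℕ using not_lt.1 hd
      simp [reducedCount_natCast, reducedExponents_zero_ncard, monomialCount_natCast]
  | succ m ih =>
    have hneg : ∀ d : ℤ, d < 0 → reducedCount q (m + 1) d =
        ∑ k ∈ Finset.range (m + 1 + 1), (-1 : ℤ) ^ k * ((m + 1).choose k : ℤ) *
          monomialCount (m + 1) (d - k * q) := by
      intro d hd
      rw [reducedCount_of_neg hd, Finset.sum_eq_zero]
      intro k _
      rw [monomialCount_of_neg, mul_zero]
      have : (0 : ℤ) ≤ k * q := by positivity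
      omega
    have hstep : ∀ d : ℤ, ∑ k ∈ Finset.range (m + 1 + 1), (-1 : ℤ) ^ k * ((m + 1).choose k : ℤ) *
          monomialCount (m + 1) (d - k * q) =
        ∑ k ∈ Finset.range (m + 1 + 1), (-1 : ℤ) ^ k * ((m + 1).choose k : ℤ) *
          monomialCount (m + 1) (d - 1 - k * q) + reducedCount q m d - reducedCount q m (d - q) := by
      intro d
      have h1 : ∀ k : ℕ, monomialCount (m + 1) (d - k * q) =
          monomialCount (m + 1) (d - 1 - k * q) + monomialCount m (d - k * q) := by
        intro k
        rw [monomialCount_succ, sub_right_comm]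
      simp only [h1, mul_add, Finset.sum_add_distrib, add_sub_assoc, add_right_inj]
      rw [ih, ih, Finset.sum_range_succ']
      -- Pascal's rule on the sign coefficient: the `m.choose k` part, shifted by `q`, assembles
      -- into `-reducedCount q m (d - q)`.
      have h2 : ∀ k : ℕ, (-1 : ℤ) ^ (k + 1) * ((m + 1).choose (k + 1) : ℤ) *
            monomialCount m (d - ((k + 1 : ℕ) : ℤ) * q) =
          (-1 : ℤ) ^ (k + 1) * (m.choose (k + 1) : ℤ) * monomialCount m (d - ((k + 1 : ℕ) : ℤ) * q)
          - (-1 : ℤ) ^ k * (m.choose k : ℤ) * monomialCount m (d - q - k * q) := by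
        intro k
        have : d - ((k + 1 : ℕ) : ℤ) * q = d - q - k * q := by push_cast; ring
        rw [this, Nat.choose_succ_succ]
        push_cast
        ring
      simp only [h2, Finset.sum_sub_distrib]
      have h3 := Finset.sum_range_succ' (fun k : ℕ => (-1 : ℤ) ^ k * (m.choose k : ℤ) *
        monomialCount m (d - k * q)) (m + 1)
      rw [Finset.sum_range_succ _ (m + 1)] at h3
      simp only [Nat.choose_succ_self, Nat.cast_zero, mul_zero, zero_mul, add_zero] at h3
      rw [h3]
      simp
      ring
    by_cases hd : d < 0
    · exact hneg d hd
    · lift d to ℕ using not_lt.1 hd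
      induction d with
      | zero => rw [reducedCount_succ_sub hq, hstep, ← hneg _ (by simp)]
      | succ d ihd =>
        rw [reducedCount_succ_sub hq, hstep]
        have : ((d + 1 : ℕ) : ℤ) - 1 = d := by push_cast; ring
        rw [this, ihd (by simp)]

end Counting

/-! ### Lower bounds for the number of nonzero values -/

section LowerBound

open Function

/-- The product is smallest when the exponents are concentrated: `k` of them equal to `q - 1`, one
to `l`, the rest `0`. Peel off `t = e 0`. If `t ≤ l`, use `(q - l) q ≤ (q - t)(q - (l - t))`; if `t
> l`, borrow `q - 1` from `k` and use `q - l ≤ (q - t)(t - l + 1)`. -/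
theorem footprint_product_bound {q : ℕ} (hq : 1 ≤ q) {m : ℕ} (e : Fin m → ℕ)
    (he : ∀ i, e i ≤ q - 1) {k l : ℕ} (hsum : ∑ i, e i ≤ k * (q - 1) + l) (hl : l ≤ q - 1)
    (hk : k + 1 ≤ m) : (q - l) * q ^ (m - k - 1) ≤ ∏ i, (q - e i) := by
  induction m generalizing k l with
  | zero => omega
  | succ m ih =>
    rw [Fin.sum_univ_succ] at hsum
    rw [Fin.prod_univ_succ]
    have ht := he 0
    set t := e 0
    rcases le_or_gt t l with htl | htl
    · obtain ⟨u, rfl⟩ := Nat.exists_eq_add_of_le htl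
      rcases le_or_gt (k + 1) m with hkm | hkm
      · have h := ih (fun i => e i.succ) (fun i => he _) (k := k) (l := u) (by omega) (by omega) hkm
        obtain ⟨a, rfl⟩ := Nat.exists_eq_add_of_le (show t + u ≤ q by omega)
        have h1 : m + 1 - k - 1 = (m - k - 1) + 1 := by omega
        have h2 : t + u + a - (t + u) = a := by omega
        have h3 : t + u + a - t = u + a := by omega
        have h4 : t + u + a - u = t + a := by omega
        rw [h4] at h
        rw [h1, h2, h3, pow_succ]
        calc a * ((t + u + a) ^ (m - k - 1) * (t + u + a))
            = (a * (t + u + a)) * (t + u + a) ^ (m - k - 1) := by ring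
          _ ≤ ((u + a) * (t + a)) * (t + u + a) ^ (m - k - 1) :=
              Nat.mul_le_mul_right _ (by nlinarith [Nat.zero_le (u * t)])
          _ = (u + a) * ((t + a) * (t + u + a) ^ (m - k - 1)) := by ring
          _ ≤ _ := Nat.mul_le_mul_left _ h
      · have h1 : m + 1 - k - 1 = 0 := by omega
        rw [h1, pow_zero]
        refine Nat.mul_le_mul (by omega) ?_
        refine Nat.one_le_iff_ne_zero.2 (Finset.prod_ne_zero_iff.2 fun i _ => ?_)
        have := he i.succ
        omega
    · obtain ⟨k, rfl⟩ : ∃ k', k = k' + 1 := by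
        cases k with
        | zero => omega
        | succ k => exact ⟨k, rfl⟩
      rw [add_one_mul] at hsum
      have h := ih (fun i => e i.succ) (fun i => he _) (k := k) (l := q - 1 + l - t) (by omega)
        (by omega) (by omega)
      obtain ⟨u, hu⟩ := Nat.exists_eq_add_of_lt htl
      obtain ⟨b, hb⟩ := Nat.exists_eq_add_of_le (show t + 1 ≤ q by omega)
      have h1 : m + 1 - (k + 1) - 1 = m - k - 1 := by omega
      have h2 : q - (q - 1 + l - t) = u + 2 := by omega
      have h3 : q - t = b + 1 := by omega
      have h4 : q - l = u + b + 2 := by omega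
      rw [h2] at h
      rw [h1, h3, h4]
      calc (u + b + 2) * q ^ (m - k - 1)
          ≤ ((b + 1) * (u + 2)) * q ^ (m - k - 1) :=
            Nat.mul_le_mul_right _ (by nlinarith [Nat.zero_le (b * u)])
        _ = (b + 1) * ((u + 2) * q ^ (m - k - 1)) := by ring
        _ ≤ _ := Nat.mul_le_mul_left _ h

variable {K : Type*} [Field K] [Finite K]

/-- The footprint bound for reduced polynomials. -/
theorem exists_footprint {m : ℕ} {p : MvPolynomial (Fin m) K} (hp : p ≠ 0)
    (hdeg : ∀ i, p.degreeOf i < Nat.card K) :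
    ∃ e : Fin m → ℕ, (∀ i, e i ≤ Nat.card K - 1) ∧ ∑ i, e i ≤ p.totalDegree ∧
      ∏ i, (Nat.card K - e i) ≤ (support (evalAlg K m p)).ncard := by
  classical
  have := Fintype.ofFinite K
  induction m with
  | zero =>
    refine ⟨fun _ => 0, fun i => i.elim0, by simp, ?_⟩
    have : support (evalAlg K 0 p) ≠ ∅ := fun h =>
      hp (eq_zero_of_evalAlg_eq_zero hdeg (support_eq_empty_iff.1 h))
    rw [Finset.prod_of_isEmpty, Nat.one_le_iff_ne_zero, Ne, Set.ncard_eq_zero (Set.toFinite _)]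
    exact this
  | succ m ih =>
    set P := MvPolynomial.finSuccEquiv K m p with hP
    have hP0 : P ≠ 0 := by simpa [hP] using hp
    set t := P.natDegree with ht
    have htq : t < Nat.card K := by
      rw [ht, hP, MvPolynomial.natDegree_finSuccEquiv]
      exact hdeg 0
    set g := P.coeff t with hg
    have hg0 : g ≠ 0 := Polynomial.leadingCoeff_ne_zero.2 hP0
    obtain ⟨e, he, hsum, hprod⟩ := ih hg0 fun j =>
      (MvPolynomial.degreeOf_coeff_finSuccEquiv p j t).trans_lt (hdeg j.succ)
    have htot : g.totalDegree + t ≤ p.totalDegree :=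
      MvPolynomial.totalDegree_coeff_finSuccEquiv_add_le p t hg0
    refine ⟨Fin.cons t e, fun i => ?_, ?_, ?_⟩
    · refine Fin.cases ?_ (fun i => ?_) i
      · simp only [Fin.cons_zero]
        omega
      · simpa using he i
    · simp only [Fin.sum_univ_succ, Fin.cons_zero, Fin.cons_succ]
      omega
    · simp only [Fin.prod_univ_succ, Fin.cons_zero, Fin.cons_succ]
      let S : Finset (Fin (m + 1) → K) := Finset.univ.filter fun x =>
        MvPolynomial.eval x p ≠ 0 ∧ MvPolynomial.eval (Fin.tail x) g ≠ 0
      let G : Finset (Fin m → K) := Finset.univ.filter fun x => MvPolynomial.eval x g ≠ 0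
      have hG : (support (evalAlg K m g)).ncard = G.card := by
        rw [← Set.ncard_coe_finset]
        congr 1
        ext x
        simp [G]
      have hS : S.card ≤ (support (evalAlg K (m + 1) p)).ncard := by
        rw [← Set.ncard_coe_finset]
        refine Set.ncard_le_ncard (fun x hx => ?_) (Set.toFinite _)
        simp only [S, Finset.coe_filter, Set.mem_ofPred_eq] at hx
        simpa using hx.2.1
      have hmaps : ∀ x ∈ S, Fin.tail x ∈ G := fun x hx => by
        simp only [S, Finset.mem_filter] at hx
        simpa [G] using hx.2.2
      -- Where the leading coefficient `g` is nonzero, `p` restricts to a nonzero polynomial in `X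
      -- 0` with at most `t` roots.
      have hfib : ∀ y ∈ G, Nat.card K - t ≤ (S.filter fun x => Fin.tail x = y).card := by
        intro y hy
        have hy0 : MvPolynomial.eval y g ≠ 0 := by simpa [G] using hy
        set Q := P.map (MvPolynomial.eval y) with hQ
        have hQ0 : Q ≠ 0 := fun h => hy0 (by
          have := congrArg (fun r => Polynomial.coeff r t) h
          simpa [hQ, hg] using this)
        have hroots : Q.roots.toFinset.card ≤ t :=
          (Multiset.toFinset_card_le _).trans ((Polynomial.card_roots' _).trans
            Polynomial.natDegree_map_le)
        have hsub : (Finset.univ \ Q.roots.toFinset).image (fun c => (Fin.cons c y : Fin (m + 1) → K)) ⊆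
            S.filter fun x => Fin.tail x = y := by
          intro x hx
          obtain ⟨c, hc, rfl⟩ := Finset.mem_image.1 hx
          have hc' : Q.eval c ≠ 0 := by simpa [hQ0] using hc
          simp only [S, Finset.mem_filter, Finset.mem_univ, true_and, Fin.tail_cons, and_true]
          refine ⟨?_, hy0⟩
          rwa [MvPolynomial.eval_eq_eval_mv_eval']
        refine le_trans ?_ (Finset.card_le_card hsub)
        rw [Finset.card_image_of_injective _ fun a b h => by simpa using congrFun h 0,
          Finset.card_sdiff_of_subset (Finset.subset_univ _), Finset.card_univ,
          ← Nat.card_eq_fintype_card]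
        omega
      calc (Nat.card K - t) * ∏ i, (Nat.card K - e i)
          ≤ (Nat.card K - t) * G.card := Nat.mul_le_mul_left _ (hG ▸ hprod)
        _ = ∑ y ∈ G, (Nat.card K - t) := by rw [Finset.sum_const, smul_eq_mul, mul_comm]
        _ ≤ ∑ y ∈ G, (S.filter fun x => Fin.tail x = y).card := Finset.sum_le_sum hfib
        _ = S.card := (Finset.card_eq_sum_card_fiberwise hmaps).symm
        _ ≤ _ := hS

theorem affine_weight_bound {W : Type*} [AddCommGroup W] [Module K W] [Finite W] {m : ℕ}
    (hm : Module.finrank K W = m) {d : ℕ} {g : W → K} (hg : g ∈ (1 ⊔ linFun K W) ^ d)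
    (hg0 : g ≠ 0) {k l : ℕ} (hd : d ≤ k * (Nat.card K - 1) + l) (hl : l ≤ Nat.card K - 1)
    (hk : k + 1 ≤ m) :
    (Nat.card K - l) * Nat.card K ^ (m - k - 1) ≤ (support g).ncard := by
  have hq : 1 < Nat.card K := Finite.one_lt_card
  let φ : (Fin m → K) ≃ₗ[K] W := LinearEquiv.ofFinrankEq _ _ (by simp [hm])
  have hmem : pullback K φ g ∈ (1 ⊔ linFun K (Fin m → K)) ^ d := by
    have h : pullback K φ g ∈ ((1 ⊔ linFun K W) ^ d).map (pullback K φ).toLinearMap := ⟨g, hg, rfl⟩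
    rw [Submodule.map_pow, Submodule.map_sup, Submodule.map_one] at h
    have h' : (linFun K W).map (pullback K φ).toLinearMap = linFun K (Fin m → K) :=
      map_pullback_linFun (φ := φ.toLinearMap) φ.injective
    rwa [h'] at h
  rw [← map_evalAlg_reduced] at hmem
  obtain ⟨p, hp, hpg⟩ := hmem
  have hp0 : p ≠ 0 := by
    rintro rfl
    apply hg0
    ext w
    simpa using (congrFun hpg (φ.symm w)).symm
  obtain ⟨e, he, hsum, hprod⟩ := exists_footprint hp0 (degreeOf_lt_of_mem_reduced hp)
  refine (footprint_product_bound hq.le e he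
    (hsum.trans ((totalDegree_le_of_mem_reduced hp).trans hd)) hl hk).trans (hprod.trans_eq ?_)
  have : evalAlg K m p = pullback K φ g := hpg
  rw [this, ← Set.ncard_image_of_injective _ φ.injective]
  congr 1
  ext w
  simp only [Set.mem_image, mem_support, pullback_apply]
  exact ⟨fun ⟨x, hx, h⟩ => h ▸ hx, fun h => ⟨φ.symm w, by simpa using h, by simp⟩⟩

/-! ### Nonzero values of homogeneous functions on the whole vector space. -/

section Cone

variable {V : Type*} [AddCommGroup V] [Module K V] [Finite V]

/-- The support is stable under nonzero scalars and avoids `0`, so it contains a punctured line. -/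
theorem card_sub_one_le_ncard_support {d : ℕ} (hd : 1 ≤ d) {f : V → K}
    (hf : f ∈ linFun K V ^ d) (hf0 : f ≠ 0) : Nat.card K - 1 ≤ (support f).ncard := by
  obtain ⟨v, hv⟩ := Function.ne_iff.1 hf0
  have hv0 : v ≠ 0 := by
    rintro rfl
    have := smul_apply_of_mem_linFun_pow hf 0 (0 : V)
    rw [zero_pow (by omega), zero_mul, smul_zero] at this
    exact hv this
  have := Fintype.ofFinite K
  classical
  rw [Nat.card_eq_fintype_card, ← Fintype.card_units, ← Nat.card_eq_fintype_card,
    ← Nat.card_coe_set_eq]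
  refine Nat.card_le_card_of_injective
    (fun c : Kˣ => (⟨(c : K) • v, ?_⟩ : support f)) fun c c' h => ?_
  · rw [mem_support, smul_apply_of_mem_linFun_pow hf]
    exact mul_ne_zero (pow_ne_zero _ c.ne_zero) hv
  · exact Units.ext (smul_left_injective K hv0 (Subtype.ext_iff.1 h))

theorem ncard_support_of_vanish_hyperplane {n d : ℕ} (hV : Module.finrank K V = n + 1)
    (hd1 : 1 ≤ d) {f : V → K} (hf : f ∈ linFun K V ^ d) (hf0 : f ≠ 0) {k l : ℕ}
    (hd : d ≤ 1 + k * (Nat.card K - 1) + l) (hl : l ≤ Nat.card K - 1) (hk : k + 1 ≤ n)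
    {u : Module.Dual K V} (hu : u ≠ 0) (hvan : ∀ v, u v = 0 → f v = 0) :
    (Nat.card K - 1) * ((Nat.card K - l) * Nat.card K ^ (n - k - 1)) ≤ (support f).ncard := by
  obtain ⟨e, rfl⟩ : ∃ e, d = e + 1 := ⟨d - 1, by omega⟩
  obtain ⟨v, hv⟩ : ∃ v, u v ≠ 0 := by
    by_contra! h
    exact hu (LinearMap.ext h)
  set z := (u v)⁻¹ • v with hz
  have huz : u z = 1 := by simp [hz, hv]
  -- Splits `V` along `z` so that `u` becomes the first coordinate; each nonzero value of `g` on the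
  -- chart then gives `q - 1` nonzero values of `f`.
  let φ : K × LinearMap.ker u →ₗ[K] V :=
    (LinearMap.toSpanSingleton K V z).coprod (LinearMap.ker u).subtype
  have hφ : ∀ c w, φ (c, w) = c • z + w := fun c w => by simp [φ]
  have hsurj : ∀ v, ∃ c w, φ (c, w) = v := fun v =>
    ⟨u v, ⟨v - u v • z, by simp [huz]⟩, by rw [hφ]; simp⟩
  have hf' : pullback K φ f ∈ linFun K (K × LinearMap.ker u) ^ (e + 1) :=
    pullback_mem_linFun_pow φ hf
  have h0 : ∀ w, pullback K φ f (0, w) = 0 := fun w => hvan _ (by simp [hφ])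
  have hg := pullback_one_mem hf' h0
  set g := pullback K (fun w : LinearMap.ker u => ((1 : K), w)) (pullback K φ f) with hgdef
  have hgf : ∀ (c : K) (w : LinearMap.ker u), f (c • (z + w)) = c ^ (e + 1) * g w := fun c w => by
    rw [smul_apply_of_mem_linFun_pow hf, hgdef, pullback_apply, pullback_apply, hφ, one_smul]
  have hg0 : g ≠ 0 := by
    intro h
    apply hf0
    ext v
    obtain ⟨c, w, rfl⟩ := hsurj v
    by_cases hc : c = 0
    · subst hc
      exact h0 w
    · have := hgf c (c⁻¹ • w)
      rw [h] at this
      simpa [smul_smul, hc, hφ] using this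
  have hker : Module.finrank K (LinearMap.ker u) = n := by
    have := Module.Dual.finrank_ker_add_one_of_ne_zero hu
    omega
  refine (Nat.mul_le_mul_left _
    (affine_weight_bound hker hg hg0 (k := k) (l := l) (by omega) hl hk)).trans ?_
  have := Fintype.ofFinite K
  classical
  rw [Nat.card_eq_fintype_card, ← Fintype.card_units, ← Nat.card_eq_fintype_card,
    ← Nat.card_coe_set_eq, ← Nat.card_prod, ← Nat.card_coe_set_eq]
  refine Nat.card_le_card_of_injective
    (fun x : Kˣ × support g => (⟨(x.1 : K) • (z + x.2.1), ?_⟩ : support f)) ?_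
  · rw [mem_support, hgf]
    exact mul_ne_zero (pow_ne_zero _ x.1.ne_zero) x.2.2
  · rintro ⟨c, w, hw⟩ ⟨c', w', hw'⟩ h
    have h1 : (c : K) • (z + (w : V)) = (c' : K) • (z + (w' : V)) := Subtype.ext_iff.1 h
    have h2 := congrArg u h1
    simp only [map_smul, map_add, huz, LinearMap.map_coe_ker, add_zero, smul_eq_mul, mul_one] at h2
    have h3 : c = c' := Units.ext h2
    subst h3
    have h4 := smul_right_injective V c.ne_zero h1
    have h5 : w = w' := Subtype.ext (add_left_cancel h4)
    subst h5
    rfl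

theorem ncard_support_of_hyperplane_bound {n A : ℕ} (hV : Module.finrank K V = n + 1) (hn : 1 ≤ n)
    {f : V → K} (hf0 : f 0 = 0)
    (hA : ∀ u : Module.Dual K V, u ≠ 0 → A ≤ {v | u v = 0 ∧ f v ≠ 0}.ncard) :
    Nat.card K * A ≤ (support f).ncard := by
  classical
  have hq : 1 < Nat.card K := Finite.one_lt_card
  have : Finite (Module.Dual K V) := DFunLike.finite _
  have := Fintype.ofFinite V
  have := Fintype.ofFinite (Module.Dual K V)
  have hdual : Module.finrank K (Module.Dual K V) = n + 1 := by
    rw [Subspace.dual_finrank_eq, hV]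
  -- Count pairs `u v = 0` with `u ≠ 0`, `f v ≠ 0`: each `u` has at least `A` partners, each `v` at
  -- most `q ^ n - 1`. Then `q (q ^ n - 1) ≤ q ^ (n + 1) - 1` gives the factor `q`.
  have hcount := Finset.card_mul_le_card_mul (s := (Finset.univ : Finset (Module.Dual K V)).erase 0)
    (t := Finset.univ.filter fun v => f v ≠ 0) (m := A) (n := Nat.card K ^ n - 1)
    (fun u v => u v = 0) ?_ ?_
  · rw [Finset.card_erase_of_mem (Finset.mem_univ _), Finset.card_univ,
      ← Nat.card_eq_fintype_card, Module.natCard_eq_pow_finrank (K := K), hdual] at hcount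
    have hW : (support f).ncard = (Finset.univ.filter fun v => f v ≠ 0).card := by
      rw [← Set.ncard_coe_finset]
      congr 1
      ext x
      simp
    rw [hW]
    have hQ : 1 < Nat.card K ^ n := Nat.one_lt_pow (by omega) hq
    refine Nat.le_of_mul_le_mul_right ?_ (Nat.sub_pos_of_lt hQ)
    refine le_trans ?_ hcount
    rw [mul_right_comm]
    refine Nat.mul_le_mul_right _ ?_
    rw [Nat.mul_sub_one, pow_succ, mul_comm (Nat.card K)]
    omega
  · intro u hu
    refine (hA u (Finset.ne_of_mem_erase hu)).trans_eq ?_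
    rw [← Set.ncard_coe_finset]
    congr 1
    ext v
    simp [Finset.bipartiteAbove, and_comm]
  · intro v hv
    have hv0 : v ≠ 0 := by
      rintro rfl
      simp [hf0] at hv
    set E := Module.Dual.eval K V v with hE
    have hE0 : E ≠ 0 := (Module.eval_apply_eq_zero_iff K v).not.2 hv0
    have hker : Module.finrank K (LinearMap.ker E) = n := by
      have := Module.Dual.finrank_ker_add_one_of_ne_zero hE0
      omega
    have hcard : (Finset.univ.filter fun u : Module.Dual K V => u v = 0).card = Nat.card K ^ n := by
      rw [← hker, ← Module.natCard_eq_pow_finrank (K := K) (V := LinearMap.ker E),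
        Nat.card_eq_fintype_card, ← Fintype.card_subtype]
      exact Fintype.card_congr (Equiv.refl _)
    rw [← hcard, ← Finset.card_erase_of_mem (a := (0 : Module.Dual K V)) (by simp)]
    refine Finset.card_le_card fun u hu => ?_
    simpa [Finset.bipartiteBelow] using hu

end Cone

theorem cone_weight_bound {n d : ℕ} (hd1 : 1 ≤ d) {k l : ℕ}
    (hd : d ≤ 1 + k * (Nat.card K - 1) + l) (hl : l ≤ Nat.card K - 1) (hk : k + 1 ≤ n)
    {V : Type*} [AddCommGroup V] [Module K V] [Finite V] (hV : Module.finrank K V = n + 1)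
    {f : V → K} (hf : f ∈ linFun K V ^ d) (hf0 : f ≠ 0) :
    (Nat.card K - 1) * ((Nat.card K - l) * Nat.card K ^ (n - k - 1)) ≤ (support f).ncard := by
  induction n generalizing V with
  | zero => omega
  | succ n ih =>
    by_cases hvan : ∃ u : Module.Dual K V, u ≠ 0 ∧ ∀ v, u v = 0 → f v = 0
    · obtain ⟨u, hu, h⟩ := hvan
      exact ncard_support_of_vanish_hyperplane hV hd1 hf hf0 hd hl hk hu h
    push Not at hvan
    have hzero : f 0 = 0 := by
      have := smul_apply_of_mem_linFun_pow hf 0 (0 : V)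
      rwa [zero_pow (by omega), zero_mul, smul_zero] at this
    have hrestrict : ∀ u : Module.Dual K V, u ≠ 0 →
        pullback K (LinearMap.ker u).subtype f ∈ linFun K (LinearMap.ker u) ^ d ∧
        pullback K (LinearMap.ker u).subtype f ≠ 0 ∧
        (support (pullback K (LinearMap.ker u).subtype f)).ncard = {v | u v = 0 ∧ f v ≠ 0}.ncard ∧
        Module.finrank K (LinearMap.ker u) = n + 1 := by
      intro u hu
      refine ⟨pullback_mem_linFun_pow _ hf, fun h => ?_, ?_, ?_⟩
      · obtain ⟨v, hv, hfv⟩ := hvan u hu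
        exact hfv (congrFun h ⟨v, hv⟩)
      · rw [← Set.ncard_image_of_injective _ (LinearMap.ker u).subtype_injective]
        congr 1
        ext v
        simp [and_comm]
      · have := Module.Dual.finrank_ker_add_one_of_ne_zero hu
        omega
    rcases le_or_gt (k + 1) n with hkn | hkn
    · have h := ncard_support_of_hyperplane_bound hV (by omega) hzero
        (A := (Nat.card K - 1) * ((Nat.card K - l) * Nat.card K ^ (n - k - 1))) fun u hu => by
          obtain ⟨h1, h2, h3, h4⟩ := hrestrict u hu
          rw [← h3]
          exact ih hkn h4 h1 h2
      refine le_trans (le_of_eq ?_) h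
      rw [show n + 1 - k - 1 = (n - k - 1) + 1 by omega, pow_succ]
      ring
    -- Here `k = n`, outside the induction hypothesis; the trivial bound `q - 1` on each hyperplane
    -- suffices, since `q - l ≤ q`.
    · have h := ncard_support_of_hyperplane_bound hV (by omega) hzero
        (A := Nat.card K - 1) fun u hu => by
          obtain ⟨h1, h2, h3, h4⟩ := hrestrict u hu
          rw [← h3]
          exact card_sub_one_le_ncard_support hd1 h1 h2
      refine le_trans ?_ h
      rw [show n + 1 - k - 1 = 0 by omega, pow_zero, mul_one, mul_comm]
      exact Nat.mul_le_mul_right _ (Nat.sub_le _ _)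

end LowerBound

/-! ### Projective Reed–Muller codes -/

section Code

open Function MvPolynomial

theorem wordWeight_eq_ncard {ι K : Type*} [Finite ι] [Field K] (c : ι → K) :
    wordWeight c = (support c).ncard := by
  classical
  unfold wordWeight hammingNorm
  rw [← Set.ncard_coe_finset]
  congr 1
  ext i
  simp

variable {K : Type*} [Field K] {n : ℕ}

theorem exists_smul_stdRep {x : Fin (n + 1) → K} (hx : x ≠ 0) :
    ∃ c : K, c ≠ 0 ∧ x = c • stdRep (Projectivization.mk K x hx) := by
  have h := mk_stdRep (Projectivization.mk K x hx)
  rw [eq_comm, Projectivization.mk_eq_mk_iff'] at h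
  obtain ⟨c, hc⟩ := h
  refine ⟨c, ?_, hc.symm⟩
  rintro rfl
  exact hx (by rw [← hc, zero_smul])

theorem stdRep_injective : Injective (stdRep : ℙ K (Fin (n + 1) → K) → Fin (n + 1) → K) := by
  intro P Q h
  rw [← mk_stdRep P, ← mk_stdRep Q]
  simp only [h]

theorem stdRep_zero_eq_one {P : ℙ K (Fin (n + 1) → K)} (h : stdRep P 0 ≠ 0) : stdRep P 0 = 1 := by
  obtain ⟨i, hi, hlt⟩ := stdRep_normalized P
  obtain rfl | h0 := eq_or_ne i 0
  · exact hi
  · exact absurd (hlt 0 (Fin.pos_of_ne_zero h0)) h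

theorem projReedMuller_eq_map (d : ℕ) : projReedMuller K n d =
    (linFun K (Fin (n + 1) → K) ^ d).map
      (pullback K (stdRep : ℙ K (Fin (n + 1) → K) → _)).toLinearMap := by
  rw [← map_evalAlg_homogeneousSubmodule]
  ext c
  constructor
  · rintro ⟨f, rfl⟩
    exact ⟨_, ⟨f.1, f.2, rfl⟩, by ext P; simp [projEval]⟩
  · rintro ⟨_, ⟨f, hf, rfl⟩, rfl⟩
    exact ⟨⟨f, hf⟩, by ext P; simp [projEval]⟩

theorem eq_zero_of_pullback_stdRep {d : ℕ} (hd : 1 ≤ d) {f : (Fin (n + 1) → K) → K}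
    (hf : f ∈ linFun K (Fin (n + 1) → K) ^ d)
    (h : pullback K (stdRep : ℙ K (Fin (n + 1) → K) → _) f = 0) : f = 0 := by
  ext x
  by_cases hx : x = 0
  · have := smul_apply_of_mem_linFun_pow hf 0 x
    rw [zero_pow (by omega), zero_mul, zero_smul] at this
    rwa [hx]
  · obtain ⟨c, -, hc⟩ := exists_smul_stdRep hx
    rw [hc, smul_apply_of_mem_linFun_pow hf]
    have : f (stdRep (Projectivization.mk K x hx)) = 0 := congrFun h _
    simp [this]

theorem finrank_projReedMuller [Finite K] {d : ℕ} (hd : 1 ≤ d) :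
    Module.finrank K (projReedMuller K n d) =
      Module.finrank K ↥(linFun K (Fin (n + 1) → K) ^ d) := by
  rw [projReedMuller_eq_map, ← LinearMap.range_domRestrict, LinearMap.finrank_range_of_inj]
  rw [injective_iff_map_eq_zero]
  exact fun f hf => Subtype.ext (eq_zero_of_pullback_stdRep hd f.2 hf)

theorem finrank_linFun_pow [Finite K] {d : ℕ} (hd : 1 ≤ d) :
    Module.finrank K ↥(linFun K (Fin n → K) ^ d) =
      ∑ j ∈ Finset.range n, (reducedExponents (Nat.card K) j (d - 1)).ncard := by
  obtain ⟨e, rfl⟩ : ∃ e, d = e + 1 := ⟨d - 1, by omega⟩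
  induction n with
  | zero =>
    have : linFun K (Fin 0 → K) ^ (e + 1) = ⊥ := by
      rw [eq_bot_iff]
      intro f hf
      ext x
      have := smul_apply_of_mem_linFun_pow hf 0 x
      rw [zero_pow (by omega), zero_mul, Subsingleton.elim ((0 : K) • x) x] at this
      exact this
    rw [this]
    simp
  | succ n ih =>
    rw [Finset.sum_range_succ, ← ih, Nat.add_sub_cancel, ← finrank_one_sup_linFun_pow,
      ← finrank_linFun_prod_pow]
    exact finrank_linFun_pow_eq_of_equiv (LinearEquiv.ofFinrankEq _ _ (by simp [add_comm])) _

theorem finrank_projReedMuller_eq_sum [Finite K] {d : ℕ} (hd : 1 ≤ d) :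
    (Module.finrank K (projReedMuller K n d) : ℤ) =
      ∑ j ∈ Finset.range (n + 1), ∑ k ∈ Finset.range (j + 1),
        (-1 : ℤ) ^ k * (j.choose k : ℤ) *
          intBinom ((j : ℤ) + d - 1 - k * Nat.card K) ((d : ℤ) - 1 - k * Nat.card K) := by
  rw [finrank_projReedMuller hd, finrank_linFun_pow hd, Nat.cast_sum]
  refine Finset.sum_congr rfl fun j _ => ?_
  rw [← reducedCount_natCast, reducedCount_eq_sum Nat.card_pos, Nat.cast_sub hd]
  refine Finset.sum_congr rfl fun k _ => ?_
  rw [monomialCount]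
  congr 2
  push_cast
  ring

theorem isMinDist_of_bounds {ι : Type*} [Finite ι] {C : Submodule K (ι → K)} {δ : ℕ}
    (hlow : ∀ c ∈ C, c ≠ 0 → δ ≤ wordWeight c) (hup : ∃ c ∈ C, c ≠ 0 ∧ wordWeight c ≤ δ) :
    IsMinDist C δ := by
  obtain ⟨c, hc, hc0, hle⟩ := hup
  refine ⟨⟨c, hc, hc0, le_antisymm (hlow c hc hc0) hle⟩, ?_⟩
  rintro _ ⟨c', hc', hc0', rfl⟩
  exact hlow c' hc' hc0'

/-! ### Minimum distance: lower bound and extremal words. -/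

variable [Finite K]

theorem ncard_support_le_mul_wordWeight {d : ℕ} (hd : 1 ≤ d) {f : (Fin (n + 1) → K) → K}
    (hf : f ∈ linFun K (Fin (n + 1) → K) ^ d) :
    (support f).ncard ≤
      (Nat.card K - 1) * wordWeight (pullback K (stdRep : ℙ K (Fin (n + 1) → K) → _) f) := by
  rw [wordWeight_eq_ncard]
  have := Fintype.ofFinite K
  classical
  rw [Nat.card_eq_fintype_card, ← Fintype.card_units, ← Nat.card_eq_fintype_card,
    ← Nat.card_coe_set_eq, ← Nat.card_coe_set_eq, ← Nat.card_prod]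
  refine Nat.card_le_card_of_surjective (α := Kˣ × Function.support _)
    (fun y => (⟨(y.1 : K) • stdRep y.2.1, ?_⟩ : support f)) ?_
  · rw [mem_support, smul_apply_of_mem_linFun_pow hf]
    exact mul_ne_zero (pow_ne_zero _ y.1.ne_zero) y.2.2
  · rintro ⟨x, hx⟩
    have hx0 : x ≠ 0 := by
      rintro rfl
      have := smul_apply_of_mem_linFun_pow hf 0 (0 : Fin (n + 1) → K)
      rw [zero_pow (by omega), zero_mul, smul_zero] at this
      exact hx this
    obtain ⟨c, hc0, hc⟩ := exists_smul_stdRep hx0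
    refine ⟨(Units.mk0 c hc0, ⟨Projectivization.mk K x hx0, ?_⟩), Subtype.ext hc.symm⟩
    rw [mem_support, pullback_apply]
    intro h
    rw [mem_support, hc, smul_apply_of_mem_linFun_pow hf, h, mul_zero] at hx
    exact hx rfl

theorem le_wordWeight {d : ℕ} (hd1 : 1 ≤ d) {k l : ℕ} (hd : d ≤ 1 + k * (Nat.card K - 1) + l)
    (hl : l ≤ Nat.card K - 1) (hk : k + 1 ≤ n) {c : ℙ K (Fin (n + 1) → K) → K}
    (hc : c ∈ projReedMuller K n d) (hc0 : c ≠ 0) :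
    (Nat.card K - l) * Nat.card K ^ (n - k - 1) ≤ wordWeight c := by
  have hq : 1 < Nat.card K := Finite.one_lt_card
  rw [projReedMuller_eq_map] at hc
  obtain ⟨f, hf, rfl⟩ := hc
  have hf0 : f ≠ 0 := by
    rintro rfl
    exact hc0 (map_zero _)
  have h := (cone_weight_bound hd1 hd hl hk (by simp) hf hf0).trans
    (ncard_support_le_mul_wordWeight hd1 hf)
  exact Nat.le_of_mul_le_mul_left h (by omega)

theorem one_le_wordWeight {c : ℙ K (Fin (n + 1) → K) → K} (hc0 : c ≠ 0) : 1 ≤ wordWeight c := by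
  rw [wordWeight_eq_ncard, Nat.one_le_iff_ne_zero, Ne, Set.ncard_eq_zero, support_eq_empty_iff]
  exact hc0

/-- A product of linear forms defines a word of small weight. -/
theorem exists_word_of_product {e : ℕ} (he : 1 ≤ e) (s : Fin n → ℕ)
    (hs : ∀ i, s i ≤ Nat.card K - 1) :
    ∃ c ∈ projReedMuller K n (e + ∑ i, s i), c ≠ 0 ∧
      wordWeight c ≤ ∏ i, (Nat.card K - s i) := by
  classical
  have := Fintype.ofFinite K
  have hq : 1 < Nat.card K := Finite.one_lt_card
  have hS : ∀ i, ∃ S : Finset K, S.card = s i := fun i => by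
    obtain ⟨S, -, hS⟩ := Finset.exists_subset_card_eq (s := (Finset.univ : Finset K)) (n := s i) (by
      rw [Finset.card_univ, ← Nat.card_eq_fintype_card]
      exact (hs i).trans (Nat.sub_le _ _))
    exact ⟨S, hS⟩
  choose S hS using hS
  -- The factor `X 0 ^ e` with `e ≥ 1` kills the hyperplane at infinity; on the chart `x 0 = 1` the
  -- survivors are the points with `x (i + 1) ∉ S i` for all `i`.
  let p : MvPolynomial (Fin (n + 1)) K :=
    X 0 ^ e * ∏ i, ∏ a ∈ S i, (X (Fin.succ i) - C a * X 0)
  have hp : p ∈ homogeneousSubmodule (Fin (n + 1)) K (e + ∑ i, s i) := by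
    refine IsHomogeneous.mul ?_ (IsHomogeneous.prod _ _ _ fun i _ => ?_)
    · simpa using (isHomogeneous_X K (0 : Fin (n + 1))).pow e
    · have := IsHomogeneous.prod (S i) (fun a => (X (Fin.succ i) - C a * X 0 :
        MvPolynomial (Fin (n + 1)) K)) (fun _ => 1) fun a _ => by
          refine (isHomogeneous_X K _).sub ?_
          simpa using (isHomogeneous_C _ a).mul (isHomogeneous_X K (0 : Fin (n + 1)))
      simpa [hS] using this
  have hval : ∀ x, eval x p = x 0 ^ e * ∏ i, ∏ a ∈ S i, (x (Fin.succ i) - a * x 0) := fun x => by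
    simp [p, map_prod]
  refine ⟨_, ⟨⟨p, hp⟩, rfl⟩, ?_, ?_⟩
  · have hb : ∀ i, ∃ b, b ∉ S i := fun i => by
      by_contra! h
      have := Finset.card_eq_iff_eq_univ (S i) |>.2 (Finset.eq_univ_of_forall h)
      rw [hS, ← Nat.card_eq_fintype_card] at this
      have := hs i
      omega
    choose b hb using hb
    set x : Fin (n + 1) → K := Fin.cons 1 b with hx
    have hx0 : x ≠ 0 := fun h => by simpa [hx] using congrFun h 0
    have hxp : eval x p ≠ 0 := by
      rw [hval]
      refine mul_ne_zero (by simp [hx]) (Finset.prod_ne_zero_iff.2 fun i _ =>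
        Finset.prod_ne_zero_iff.2 fun a ha => ?_)
      simp only [hx, Fin.cons_succ, Fin.cons_zero, mul_one]
      exact sub_ne_zero.2 fun h => hb i (h ▸ ha)
    intro h
    have h1 : evalAlg K (n + 1) p ∈ linFun K (Fin (n + 1) → K) ^ (e + ∑ i, s i) := by
      rw [← map_evalAlg_homogeneousSubmodule]
      exact ⟨p, hp, rfl⟩
    have h2 := eq_zero_of_pullback_stdRep (by omega) h1 (by
      ext P
      simpa [projEval] using congrFun h P)
    exact hxp (by rw [← evalAlg_apply, h2, Pi.zero_apply])
  · rw [wordWeight_eq_ncard]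
    have hcard : ∏ i, (Nat.card K - s i) = (Fintype.piFinset fun i => (S i)ᶜ).card := by
      rw [Fintype.card_piFinset]
      refine Finset.prod_congr rfl fun i _ => ?_
      rw [Finset.card_compl, hS, Nat.card_eq_fintype_card]
    rw [hcard, ← Set.ncard_coe_finset]
    have hsupp : ∀ P ∈ support (projEval K n (e + ∑ i, s i) ⟨p, hp⟩),
        stdRep P 0 = 1 ∧ ∀ i, stdRep P (Fin.succ i) ∉ S i := by
      intro P hP
      have hP' : eval (stdRep P) p ≠ 0 := hP
      rw [hval] at hP'
      obtain ⟨h1, h2⟩ := mul_ne_zero_iff.1 hP'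
      have h3 := stdRep_zero_eq_one (fun h => h1 (by rw [h, zero_pow (by omega)]))
      refine ⟨h3, fun i hi => ?_⟩
      have := Finset.prod_ne_zero_iff.1 (Finset.prod_ne_zero_iff.1 h2 i (Finset.mem_univ _)) _ hi
      rw [h3, mul_one, sub_self] at this
      exact this rfl
    refine Set.ncard_le_ncard_of_injOn (fun P => Fin.tail (stdRep P)) (fun P hP => ?_) ?_
      (Set.toFinite _)
    · simpa [Fin.tail] using (hsupp P hP).2
    · intro P hP Q hQ h
      apply stdRep_injective
      rw [← Fin.cons_self_tail (stdRep P), ← Fin.cons_self_tail (stdRep Q), (hsupp P hP).1,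
        (hsupp Q hQ).1]
      simp only at h
      rw [h]

theorem exists_extremal_exponents (q : ℕ) {n k l : ℕ} (hk : k + 1 ≤ n) (hl : l ≤ q - 1)
    (hq : 1 ≤ q) : ∃ s : Fin n → ℕ, (∀ i, s i ≤ q - 1) ∧ ∑ i, s i = k * (q - 1) + l ∧
      ∏ i, (q - s i) = (q - l) * q ^ (n - k - 1) := by
  obtain ⟨n, rfl⟩ : ∃ m, n = m + 1 := ⟨n - 1, by omega⟩
  induction k generalizing n with
  | zero =>
    refine ⟨Fin.cons l fun _ => 0, fun i => ?_, ?_, ?_⟩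
    · refine Fin.cases ?_ (fun i => ?_) i <;> simp [hl]
    · simp [Fin.sum_univ_succ]
    · simp [Fin.prod_univ_succ]
  | succ k ih =>
    obtain ⟨n, rfl⟩ : ∃ m, n = m + 1 := ⟨n - 1, by omega⟩
    obtain ⟨s, h1, h2, h3⟩ := ih n (by omega)
    refine ⟨Fin.cons (q - 1) s, fun i => ?_, ?_, ?_⟩
    · refine Fin.cases ?_ (fun i => ?_) i
      · simp
      · simpa using h1 i
    · rw [Fin.sum_univ_succ]
      simp only [Fin.cons_zero, Fin.cons_succ, h2]
      ring
    · rw [Fin.prod_univ_succ]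
      simp only [Fin.cons_zero, Fin.cons_succ, h3]
      rw [Nat.sub_sub_self hq, one_mul]
      congr 2
      omega

theorem isMinDist_projReedMuller_one : IsMinDist (projReedMuller K n 1) (Nat.card K ^ n) := by
  refine isMinDist_of_bounds (fun c hc hc0 => ?_) ?_
  · rcases Nat.eq_zero_or_pos n with rfl | hn
    · simpa using one_le_wordWeight hc0
    -- Degree one is the general bound with `l = 0`: `q * q ^ (n - 1) = q ^ n`.
    · have h := le_wordWeight le_rfl (k := 0) (l := 0) (by omega) (by omega) (by omega) hc hc0
      rwa [Nat.sub_zero, ← pow_succ', Nat.sub_zero, Nat.sub_add_cancel hn] at h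
  · simpa using exists_word_of_product (K := K) le_rfl (fun _ : Fin n => 0) (by simp)

theorem isMinDist_projReedMuller {k l : ℕ} (hk : k + 1 ≤ n) (hl : l ≤ Nat.card K - 1) :
    IsMinDist (projReedMuller K n (1 + k * (Nat.card K - 1) + l))
      ((Nat.card K - l) * Nat.card K ^ (n - k - 1)) := by
  refine isMinDist_of_bounds (fun c hc hc0 => le_wordWeight (by omega) le_rfl hl hk hc hc0) ?_
  obtain ⟨s, h1, h2, h3⟩ := exists_extremal_exponents (Nat.card K) hk hl Nat.card_pos
  have h := exists_word_of_product (K := K) le_rfl s h1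
  rwa [h2, h3, ← add_assoc] at h

theorem isMinDist_projReedMuller_of_lt {d : ℕ} (hd : n * (Nat.card K - 1) < d) :
    IsMinDist (projReedMuller K n d) 1 := by
  refine isMinDist_of_bounds (fun c _ hc0 => one_le_wordWeight hc0) ?_
  have h := exists_word_of_product (K := K) (e := d - n * (Nat.card K - 1)) (by omega)
    (fun _ : Fin n => Nat.card K - 1) (by simp)
  have h1 : Nat.card K - (Nat.card K - 1) = 1 := Nat.sub_sub_self Nat.card_pos
  simpa [h1, Nat.sub_add_cancel hd.le] using h

end Code

/-! ### The decomposition of `d` and the final statement. -/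

theorem existsUnique_degree_decomposition {q n d : ℕ} (hq : 1 < q) (hd : 1 < d)
    (hdn : d ≤ n * (q - 1)) :
    ∃! p : ℕ × ℕ, p.1 ≤ n - 1 ∧ 1 ≤ p.2 ∧ p.2 ≤ q - 1 ∧ d = 1 + p.1 * (q - 1) + p.2 := by
  have hr : 0 < q - 1 := by omega
  generalize q - 1 = r at *
  -- As `l` starts at `1`, this is Euclidean division of `d - 2` by `q - 1`, with remainder `l - 1`.
  refine ⟨((d - 2) / r, (d - 2) % r + 1), ⟨?_, by simp, Nat.mod_lt _ hr, ?_⟩, ?_⟩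
  · refine Nat.le_sub_one_of_lt (Nat.div_lt_of_lt_mul ?_)
    rw [mul_comm]
    omega
  · have := Nat.div_add_mod' (d - 2) r
    simp only
    omega
  · rintro ⟨k, l⟩ ⟨-, h1, h2, h3⟩
    simp only at h1 h2 h3
    have h4 : d - 2 = (l - 1) + r * k := by
      rw [mul_comm]
      omega
    have h5 : (d - 2) / r = k := by
      rw [h4, Nat.add_mul_div_left _ _ hr, Nat.div_eq_of_lt (by omega), zero_add]
    have h6 : (d - 2) % r = l - 1 := by
      rw [h4, Nat.add_mul_mod_self_left, Nat.mod_eq_of_lt (by omega)]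
    rw [h5, h6, Nat.sub_add_cancel h1]

theorem mainTheorem5 (K : Type*) [Field K] [Finite K] (q : ℕ) (hq : Nat.card K = q)
    (n d : ℕ) (hd : 1 ≤ d) :
    -- length
    ((Nat.card (ℙ K (Fin (n + 1) → K)) : ℚ) = ((q : ℚ) ^ (n + 1) - 1) / ((q : ℚ) - 1)) ∧
    -- dimension
    ((Module.finrank K (projReedMuller K n d) : ℤ) =
      ∑ j ∈ Finset.range (n + 1), ∑ k ∈ Finset.range (j + 1),
        (-1 : ℤ) ^ k * (j.choose k : ℤ) *
          intBinom ((j : ℤ) + d - 1 - k * q) ((d : ℤ) - 1 - k * q)) ∧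
    -- minimum distance
    (d = 1 → IsMinDist (projReedMuller K n d) (q ^ n)) ∧
    (1 < d → d ≤ n * (q - 1) →
      (∃! p : ℕ × ℕ, p.1 ≤ n - 1 ∧ 1 ≤ p.2 ∧ p.2 ≤ q - 1 ∧ d = 1 + p.1 * (q - 1) + p.2) ∧
      ∀ k l : ℕ, k ≤ n - 1 → 1 ≤ l → l ≤ q - 1 → d = 1 + k * (q - 1) + l →
        IsMinDist (projReedMuller K n d) ((q - l) * q ^ (n - k - 1))) ∧
    (n * (q - 1) < d → IsMinDist (projReedMuller K n d) 1) := by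
  subst hq
  have hq : 1 < Nat.card K := Finite.one_lt_card
  refine ⟨?_, finrank_projReedMuller_eq_sum hd, ?_, fun hd1 hdn => ⟨?_, ?_⟩,
    isMinDist_projReedMuller_of_lt⟩
  · rw [Projectivization.card_of_finrank K _ (n := n + 1) (by simp), ← geom_sum_eq (by
      exact_mod_cast hq.ne')]
    push_cast
    rfl
  · rintro rfl
    exact isMinDist_projReedMuller_one
  · exact existsUnique_degree_decomposition hq hd1 hdn
  · rintro k l hk - hl rfl
    -- `n - 1` truncates at `n = 0`, so that case is excluded before `k ≤ n - 1` yields `k + 1 ≤ n`.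
    have hn : n ≠ 0 := by
      rintro rfl
      omega
    exact isMinDist_projReedMuller (by omega) hl
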